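/- Let $\mathbb F$ be a field with $\operatorname{char}\mathbb F\neq 2,3$, let $n$ be a natural number and let $M_n$ be the Lie algebra of $n\times n$ matrices over $\mathbb F$ with bracket $[X,Y]=XY-YX$. A ladder of size $n$ is a (possibly empty) set $\mathcal L=\{(i_1,j_1),\dots,(i_s,j_s)\}\subseteq[n]\times[n]$ with $i_1<\dots<i_s$ and $j_1<\dots<j_s$; it is strongly dominant upper triangular (SDUT) if $j_\ell<i_\ell$ for all $1\le \ell\le s$ and $i_\ell<j_{\ell+1}$ for all $1\le\ell\le s-1$. Let $M_{\mathcal L}$ be the span of the standard matrices $E_{ij}$ with $i\le i_\ell$ and $j\ge j_\ell$ for some $\ell$. Partition the rows and the columns of the matrices in $M_n$ right after the positions in $(\{i_1,\dots,i_s\}\cup\{j_1-1,\dots,j_s-1\})\setminus\{0,n\}$, and let $M_{\mathcal L}^0$ be the set of all matrices in $M_{\mathcal L}$ each of whose diagonal blocks with respect to this partition has trace zero. If $\mathcal L$ is SDUT, then $M_{\mathcal L}$ and $M_{\mathcal L}^0$ are Lie subalgebras of $M_n$. Write $\operatorname{Der}(\mathfrak g)$ for the Lie algebra of derivations of a Lie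 algebra $\mathfrak g$, let $\operatorname{cen}(M_{\mathcal L})=\{A\in M_n:[A,B]=0\text{ for all }B\in M_{\mathcal L}\}$, and put $$\mathcal D=\{\phi\in\operatorname{End}_{\mathbb F}(M_{\mathcal L}):\ \operatorname{Ker}\phi\supseteq[M_{\mathcal L},M_{\mathcal L}],\ \operatorname{Im}\phi\subseteq\operatorname{cen}(M_{\mathcal L})\cap M_{\mathcal L}\},$$ a Lie algebra under the commutator of linear maps. Corollary. Let $\mathcal L$ be an SDUT ladder of size $n$. Then $\mathcal D\subseteq\operatorname{Der}(M_{\mathcal L})$, every derivation of $M_{\mathcal L}$ maps $M_{\mathcal L}^0$ into itself, and with the inclusion of $\mathcal D$ and the restriction map $\pi(f)=f|_{M_{\mathcal L}^0}$ the sequence $$0\to\mathcal D\hookrightarrow\operatorname{Der}(M_{\mathcal L})\xrightarrow{\ \pi\ }\operatorname{Der}(M_{\mathcal L}^0)\to0$$ is a split exact sequence of Lie algebras: it is exact, and there is a Lie algebra homomorphism $\sigma:\operatorname{Der}(M_{\mathcal L}^0)\to\operatorname{Der}(M_{\mathcal L})$ with $\pi\circ\sigma=\mathrm{id}$. -/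

import Mathlib

attribute [local instance 100] LieRing.ofAssociativeRing

/-- A ladder of step `s` and size `n`: corner points `(i_1,j_1), …, (i_s,j_s)` in `[n] × [n]` with
`i_1 < ⋯ < i_s` and `j_1 < ⋯ < j_s`. Indices are `0`-based: the index `a : Fin n` stands for the
element `a + 1` of `[n] = {1, …, n}`. The empty ladder (`s = 0`) is allowed. -/
structure Ladder (n : ℕ) where
  /-- the number of corner points -/
  step : ℕ
  /-- the row indices `i_ℓ` of the corner points -/
  row : Fin step → Fin n
  /-- the column indices `j_ℓ` of the corner points -/
  col : Fin step → Fin n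
  row_strictMono : StrictMono row
  col_strictMono : StrictMono col

namespace Ladder

variable {n : ℕ}

/-- `I(L)`: the pairs `(i, j)` that are dominated by some corner point, i.e. `i ≤ i_ℓ`
and `j_ℓ ≤ j` for some `ℓ`. -/
def indexSet (L : Ladder n) : Set (Fin n × Fin n) :=
  {p | ∃ l, p.1 ≤ L.row l ∧ L.col l ≤ p.2}

/-- Upper triangular ladder: `i_ℓ < j_{ℓ+1}` for `1 ≤ ℓ ≤ s - 1`. -/
def IsUpperTriangular (L : Ladder n) : Prop :=
  ∀ (l : ℕ) (h : l + 1 < L.step), L.row ⟨l, by omega⟩ < L.col ⟨l + 1, h⟩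

/-- Strongly dominant upper triangular (SDUT) ladder: `j_ℓ < i_ℓ` for every corner point, and
`i_ℓ < j_{ℓ+1}` for `1 ≤ ℓ ≤ s - 1`. -/
def IsSDUT (L : Ladder n) : Prop :=
  (∀ l, L.col l < L.row l) ∧ L.IsUpperTriangular

theorem IsSDUT.isUpperTriangular {L : Ladder n} (h : L.IsSDUT) : L.IsUpperTriangular := h.2

/-- The partition `γ_L = ({i_1, …, i_s} ∪ {j_1 - 1, …, j_s - 1}) ∖ {0, n}`. In `1`-based terms
`c ∈ γ_L` means that the rows and columns are cut right after the `c`-th one; the `1`-based numbers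
`i_ℓ` and `j_ℓ - 1` are `row ℓ + 1` and `col ℓ` in terms of the `0`-based indices. -/
def cuts (L : Ladder n) : Finset ℕ :=
  (Finset.univ.image (fun l => (L.row l : ℕ) + 1) ∪ Finset.univ.image (fun l => (L.col l : ℕ)))
    \ {0, n}

/-- The number (starting from `0`) of the block of the partition `γ_L` that contains the index `a`:
the number of cuts that are made before `a`. -/
def blockIndex (L : Ladder n) (a : Fin n) : ℕ :=
  (L.cuts.filter (fun c => c ≤ (a : ℕ))).card

theorem IsUpperTriangular.row_lt_col {L : Ladder n} (h : L.IsUpperTriangular)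
    {l m : Fin L.step} (hlm : l < m) : L.row l < L.col m := by
  have h1 : (l : ℕ) + 1 < L.step := lt_of_le_of_lt hlm m.2
  refine (h l h1).trans_le (L.col_strictMono.monotone ?_)
  exact hlm

theorem IsUpperTriangular.indexSet_trans {L : Ladder n} (h : L.IsUpperTriangular)
    {i j k : Fin n} (hij : (i, j) ∈ L.indexSet) (hjk : (j, k) ∈ L.indexSet) :
    (i, k) ∈ L.indexSet := by
  obtain ⟨l, hl1, hl2⟩ := hij
  obtain ⟨m, hm1, hm2⟩ := hjk
  rcases le_or_gt l m with hlm | hlm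
  · exact ⟨m, hl1.trans (L.row_strictMono.monotone hlm), hm2⟩
  · exact absurd (hl2.trans hm1) (not_le.mpr (h.row_lt_col hlm))

theorem IsUpperTriangular.blockIndex_le {L : Ladder n} (h : L.IsUpperTriangular)
    {i j : Fin n} (hij : (i, j) ∈ L.indexSet) : L.blockIndex i ≤ L.blockIndex j := by
  obtain ⟨l, hl1, hl2⟩ := hij
  refine Finset.card_le_card fun c hc => ?_
  simp only [Finset.mem_filter, cuts, Finset.mem_sdiff, Finset.mem_union, Finset.mem_image,
    Finset.mem_univ, true_and] at hc ⊢
  obtain ⟨⟨hc1, hc2⟩, hci⟩ := hc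
  refine ⟨⟨hc1, hc2⟩, ?_⟩
  simp only [Fin.le_def] at hl1 hl2
  rcases hc1 with ⟨m, rfl⟩ | ⟨m, rfl⟩
  · have hml : m < l := L.row_strictMono.lt_iff_lt.mp (by rw [Fin.lt_def]; omega)
    have h2 := h.row_lt_col hml
    rw [Fin.lt_def] at h2
    omega
  · by_contra hcon
    have hlm : l < m := L.col_strictMono.lt_iff_lt.mp (by rw [Fin.lt_def]; omega)
    have h2 := h.row_lt_col hlm
    rw [Fin.lt_def] at h2
    omega

section Algebra

variable (F : Type*) [Field F]

/-- `M_L`, the span of the standard matrices `E_{ij}` with `(i, j) ∈ I(L)`. -/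
def matrices (L : Ladder n) : Submodule F (Matrix (Fin n) (Fin n) F) :=
  Submodule.span F {E | ∃ p ∈ L.indexSet, E = Matrix.single p.1 p.2 1}

variable {F}

theorem mem_matrices_iff (L : Ladder n) (A : Matrix (Fin n) (Fin n) F) :
    A ∈ L.matrices F ↔ ∀ i j, (i, j) ∉ L.indexSet → A i j = 0 := by
  constructor
  · intro hA
    refine Submodule.span_induction (p := fun A _ => ∀ i j, (i, j) ∉ L.indexSet → A i j = 0)
      ?_ ?_ ?_ ?_ hA
    · rintro _ ⟨p, hp, rfl⟩ i j hij
      refine Matrix.single_apply_of_ne _ _ _ _ _ ?_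
      rintro ⟨rfl, rfl⟩
      exact hij hp
    · intro i j _
      rfl
    · intro A B _ _ hA hB i j hij
      rw [Matrix.add_apply, hA i j hij, hB i j hij, add_zero]
    · intro c A _ hA i j hij
      rw [Matrix.smul_apply, hA i j hij, smul_zero]
  · intro hA
    rw [Matrix.matrix_eq_sum_single A]
    refine Submodule.sum_mem _ fun i _ => Submodule.sum_mem _ fun j _ => ?_
    by_cases hij : (i, j) ∈ L.indexSet
    · have h1 : Matrix.single i j (A i j) = A i j • Matrix.single i j (1 : F) := by
        rw [Matrix.smul_single, smul_eq_mul, mul_one]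
      rw [h1]
      exact Submodule.smul_mem _ _ (Submodule.subset_span ⟨(i, j), hij, rfl⟩)
    · rw [hA i j hij, Matrix.single_zero]
      exact Submodule.zero_mem _

theorem mul_mem_matrices {L : Ladder n} (h : L.IsUpperTriangular)
    {A B : Matrix (Fin n) (Fin n) F} (hA : A ∈ L.matrices F) (hB : B ∈ L.matrices F) :
    A * B ∈ L.matrices F := by
  rw [mem_matrices_iff] at *
  intro i k hik
  rw [Matrix.mul_apply]
  refine Finset.sum_eq_zero fun j _ => ?_
  by_cases hij : (i, j) ∈ L.indexSet
  · rw [hB j k fun hjk => hik (h.indexSet_trans hij hjk), mul_zero]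
  · rw [hA i j hij, zero_mul]

variable (F)

/-- `M_L` as a Lie subalgebra of `M_n` (with `[X, Y] = XY - YX`), for an upper triangular
ladder `L`. -/
def lieMatrices (L : Ladder n) (h : L.IsUpperTriangular) :
    LieSubalgebra F (Matrix (Fin n) (Fin n) F) :=
  { L.matrices F with
    lie_mem' := fun {A B} hA hB => by
      rw [Ring.lie_def]
      exact Submodule.sub_mem _ (mul_mem_matrices h hA hB) (mul_mem_matrices h hB hA) }

variable {F}

theorem mem_lieMatrices_iff {L : Ladder n} (h : L.IsUpperTriangular)
    (A : Matrix (Fin n) (Fin n) F) :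
    A ∈ L.lieMatrices F h ↔ ∀ i j, (i, j) ∉ L.indexSet → A i j = 0 :=
  L.mem_matrices_iff A

/-- The trace of the `k`-th diagonal block (with respect to the partition `γ_L`) of a matrix. -/
def blockTrace (L : Ladder n) (k : ℕ) (A : Matrix (Fin n) (Fin n) F) : F :=
  ∑ a ∈ Finset.univ.filter (fun a => L.blockIndex a = k), A a a

theorem blockTrace_mul_comm {L : Ladder n} (h : L.IsUpperTriangular) (k : ℕ)
    {A B : Matrix (Fin n) (Fin n) F} (hA : A ∈ L.matrices F) (hB : B ∈ L.matrices F) :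
    L.blockTrace k (A * B) = L.blockTrace k (B * A) := by
  rw [mem_matrices_iff] at hA hB
  have key : ∀ {A B : Matrix (Fin n) (Fin n) F},
      (∀ i j, (i, j) ∉ L.indexSet → A i j = 0) → (∀ i j, (i, j) ∉ L.indexSet → B i j = 0) →
      L.blockTrace k (A * B) =
        ∑ a ∈ Finset.univ.filter (fun a => L.blockIndex a = k),
          ∑ b ∈ Finset.univ.filter (fun a => L.blockIndex a = k), A a b * B b a := by
    intro A B hA hB
    refine Finset.sum_congr rfl fun a ha => ?_
    rw [Matrix.mul_apply]
    symm
    refine Finset.sum_subset (Finset.filter_subset _ _) fun b _ hb => ?_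
    simp only [Finset.mem_filter, Finset.mem_univ, true_and] at ha hb
    by_cases hab : (a, b) ∈ L.indexSet
    · by_cases hba : (b, a) ∈ L.indexSet
      · exact absurd ((le_antisymm (h.blockIndex_le hba) (h.blockIndex_le hab)).trans ha) hb
      · rw [hB b a hba, mul_zero]
    · rw [hA a b hab, zero_mul]
  rw [key hA hB, key hB hA, Finset.sum_comm]
  exact Finset.sum_congr rfl fun _ _ => Finset.sum_congr rfl fun _ _ => mul_comm _ _

variable (F)

/-- `M_L^0`: the Lie algebra of the matrices in `M_L` whose diagonal blocks, with respect to the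
partition `γ_L`, all have trace zero. -/
def lieMatricesZero (L : Ladder n) (h : L.IsUpperTriangular) :
    LieSubalgebra F (Matrix (Fin n) (Fin n) F) where
  carrier := {A | A ∈ L.lieMatrices F h ∧ ∀ k, L.blockTrace k A = 0}
  add_mem' := by
    rintro A B ⟨hA, hA'⟩ ⟨hB, hB'⟩
    refine ⟨add_mem hA hB, fun k => ?_⟩
    have h1 : L.blockTrace k (A + B) = L.blockTrace k A + L.blockTrace k B :=
      Finset.sum_add_distrib
    rw [h1, hA', hB', add_zero]
  zero_mem' := ⟨zero_mem _, fun k => Finset.sum_const_zero⟩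
  smul_mem' := by
    rintro c A ⟨hA, hA'⟩
    refine ⟨(L.lieMatrices F h).smul_mem c hA, fun k => ?_⟩
    have h1 : L.blockTrace k (c • A) = c * L.blockTrace k A := (Finset.mul_sum _ _ _).symm
    rw [h1, hA', mul_zero]
  lie_mem' := by
    rintro A B ⟨hA, _⟩ ⟨hB, _⟩
    refine ⟨(L.lieMatrices F h).lie_mem hA hB, fun k => ?_⟩
    have h1 : L.blockTrace k ⁅A, B⁆ = L.blockTrace k (A * B) - L.blockTrace k (B * A) :=
      Finset.sum_sub_distrib _ _
    rw [h1, blockTrace_mul_comm h k hA hB, sub_self]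

variable {F}

theorem lieMatricesZero_le (L : Ladder n) (h : L.IsUpperTriangular) :
    L.lieMatricesZero F h ≤ L.lieMatrices F h := fun _ hA => hA.1

end Algebra

end Ladder

/-- The centralizer `{A ∈ M_n : [A, B] = 0 for all B ∈ K}` of a Lie subalgebra `K` of `M_n`. -/
def matrixCentralizer {n : ℕ} {F : Type*} [Field F]
    (K : LieSubalgebra F (Matrix (Fin n) (Fin n) F)) :
    Submodule F (Matrix (Fin n) (Fin n) F) where
  carrier := {A | ∀ B ∈ K, ⁅A, B⁆ = 0}
  add_mem' := by
    intro A A' hA hA' B hB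
    rw [add_lie, hA B hB, hA' B hB, add_zero]
  zero_mem' := fun B _ => zero_lie B
  smul_mem' := by
    intro c A hA B hB
    rw [smul_lie, hA B hB, smul_zero]

/-- The Lie algebra, under the commutator bracket of `End(K)`, of all linear maps `φ : K → K` with
`Ker φ ⊇ [K, K]` and `Im φ ⊆ C ∩ K`, where `C` is the centralizer of `K` in `M_n`. -/
def centralMaps {n : ℕ} {F : Type*} [Field F]
    (K : LieSubalgebra F (Matrix (Fin n) (Fin n) F)) :
    LieSubalgebra F (Module.End F K) where
  carrier := {φ | (⁅(⊤ : LieIdeal F K), (⊤ : LieIdeal F K)⁆ : LieIdeal F K).toSubmodule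
      ≤ LinearMap.ker φ ∧
    (LinearMap.range φ).map K.toSubmodule.subtype ≤ matrixCentralizer K ⊓ K.toSubmodule}
  add_mem' := by
    rintro φ ψ ⟨hφ, hφ'⟩ ⟨hψ, hψ'⟩
    refine ⟨fun x hx => ?_, ?_⟩
    · have h1 : φ x = 0 := hφ hx
      have h2 : ψ x = 0 := hψ hx
      rw [LinearMap.mem_ker, LinearMap.add_apply, h1, h2, add_zero]
    · rintro _ ⟨_, ⟨x, rfl⟩, rfl⟩
      exact add_mem (hφ' ⟨_, ⟨x, rfl⟩, rfl⟩) (hψ' ⟨_, ⟨x, rfl⟩, rfl⟩)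
  zero_mem' := by
    refine ⟨fun x _ => rfl, ?_⟩
    rintro _ ⟨_, ⟨x, rfl⟩, rfl⟩
    exact zero_mem _
  smul_mem' := by
    rintro c φ ⟨hφ, hφ'⟩
    refine ⟨fun x hx => ?_, ?_⟩
    · have h1 : φ x = 0 := hφ hx
      rw [LinearMap.mem_ker, LinearMap.smul_apply, h1, smul_zero]
    · rintro _ ⟨_, ⟨x, rfl⟩, rfl⟩
      exact Submodule.smul_mem _ c (hφ' ⟨_, ⟨x, rfl⟩, rfl⟩)
  lie_mem' := by
    rintro φ ψ ⟨hφ, hφ'⟩ ⟨hψ, hψ'⟩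
    refine ⟨fun x hx => ?_, ?_⟩
    · have h1 : φ x = 0 := hφ hx
      have h2 : ψ x = 0 := hψ hx
      rw [LinearMap.mem_ker, Ring.lie_def, LinearMap.sub_apply, Module.End.mul_apply,
        Module.End.mul_apply, h1, h2, map_zero, map_zero, sub_zero]
    · rintro _ ⟨_, ⟨x, rfl⟩, rfl⟩
      exact sub_mem (hφ' ⟨_, ⟨ψ x, rfl⟩, rfl⟩) (hψ' ⟨_, ⟨φ x, rfl⟩, rfl⟩)

/-! Two facts carry the theorem. First, every derivation of M_L^0 is X ↦ [A, X] for some matrix A in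
M_n (`exists_matrix`). Second, a matrix commuting with M_L^0 commutes with M_L
(`lie_eq_zero_of_forall_lieMatricesZero`): since j_ℓ < i_ℓ, each E_ii in M_L is a product E_ia E_ai
with a ≠ i, so the off-diagonal units in M_L^0 generate M_L under multiplication.

Given both, ad A also preserves M_L, and its action there depends only on the derivation, not on the
choice of A. This makes the extension a Lie homomorphism splitting π. For the kernel, M_L^0 = [M_L,
M_L]; if f vanishes there, then 0 = f[X, C] = [f X, C] for C in M_L^0, so f X is central.

For the first fact, comparing weights under the elements E_aa - E_bb of M_L^0 confines D(E_ij) to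
row i and column j (`img_eq_zero`); this uses char ≠ 2, 3. The off-diagonal entries A_ki are then
read off from column j, or up to sign from a row, consistently (`img_col_eq`, `img_row_eq`,
`img_col_eq_neg_row`). The (i, j) entries of D(E_ij) form an additive cocycle on I(L), which is a
coboundary a_i - a_j (`exists_coeff_eq_sub`); the a_i form the diagonal of A. -/

theorem Matrix.mul_single_one_apply {n : ℕ} {F : Type*} [Field F] (M : Matrix (Fin n) (Fin n) F)
    (i j a b : Fin n) : (M * Matrix.single i j (1 : F)) a b = if b = j then M a i else 0 := by
  split_ifs with hb
  · subst hb
    rw [Matrix.mul_single_apply_same, mul_one]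
  · exact Matrix.mul_single_apply_of_ne _ _ _ _ _ hb _

theorem Matrix.single_one_mul_apply {n : ℕ} {F : Type*} [Field F] (M : Matrix (Fin n) (Fin n) F)
    (i j a b : Fin n) : (Matrix.single i j (1 : F) * M) a b = if a = i then M j b else 0 := by
  split_ifs with ha
  · subst ha
    rw [Matrix.single_mul_apply_same, one_mul]
  · exact Matrix.single_mul_apply_of_ne _ _ _ _ _ ha _

/-! ### Combinatorics of the index set I(L) and of the blocks. -/

namespace Ladder

variable {n : ℕ} {L : Ladder n}

/-- The only place where the strict inequality j_ℓ < i_ℓ is needed: the interval [j_ℓ, i_ℓ] has at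
least two elements, so one index can be avoided. -/
theorem IsSDUT.exists_ne {l : Fin L.step} (hL : L.IsSDUT) (k : Fin n) :
    ∃ b, b ≠ k ∧ L.col l ≤ b ∧ b ≤ L.row l := by
  rcases eq_or_ne (L.col l) k with rfl | h
  · exact ⟨L.row l, (hL.1 l).ne', (hL.1 l).le, le_rfl⟩
  · exact ⟨L.col l, h, le_rfl, (hL.1 l).le⟩

theorem IsSDUT.exists_between (hL : L.IsSDUT) {i j : Fin n} (hij : (i, j) ∈ L.indexSet)
    (k : Fin n) : ∃ b, b ≠ k ∧ (i, b) ∈ L.indexSet ∧ (b, j) ∈ L.indexSet ∧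
      (b, b) ∈ L.indexSet := by
  obtain ⟨l, hi, hj⟩ := hij
  obtain ⟨b, hbk, h1, h2⟩ := hL.exists_ne (l := l) k
  exact ⟨b, hbk, ⟨l, hi, h1⟩, ⟨l, h2, hj⟩, ⟨l, h2, h1⟩⟩

theorem IsSDUT.exists_equiv (hL : L.IsSDUT) {i : Fin n} (hi : (i, i) ∈ L.indexSet) :
    ∃ a, a ≠ i ∧ (i, a) ∈ L.indexSet ∧ (a, i) ∈ L.indexSet := by
  obtain ⟨a, h, h1, h2, -⟩ := hL.exists_between hi i
  exact ⟨a, h, h1, h2⟩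

/-- The earlier of the two corners dominates both positions, because its column index is the smaller
one. -/
theorem IsSDUT.exists_common_col (hL : L.IsSDUT) {i j m : Fin n} (hij : (i, j) ∈ L.indexSet)
    (him : (i, m) ∈ L.indexSet) (k : Fin n) :
    ∃ b, b ≠ k ∧ (i, b) ∈ L.indexSet ∧ (b, j) ∈ L.indexSet ∧ (b, m) ∈ L.indexSet := by
  obtain ⟨l, hl, hj⟩ := hij
  obtain ⟨l', hl', hm⟩ := him
  rcases le_total l l' with h | h
  · obtain ⟨b, hbk, h1, h2⟩ := hL.exists_ne (l := l) k
    exact ⟨b, hbk, ⟨l, hl, h1⟩, ⟨l, h2, hj⟩, ⟨l, h2, (L.col_strictMono.monotone h).trans hm⟩⟩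
  · obtain ⟨b, hbk, h1, h2⟩ := hL.exists_ne (l := l') k
    exact ⟨b, hbk, ⟨l', hl', h1⟩, ⟨l', h2, (L.col_strictMono.monotone h).trans hj⟩, ⟨l', h2, hm⟩⟩

theorem IsSDUT.exists_common_row (hL : L.IsSDUT) {i l j : Fin n} (hij : (i, j) ∈ L.indexSet)
    (hlj : (l, j) ∈ L.indexSet) (k : Fin n) :
    ∃ b, b ≠ k ∧ (i, b) ∈ L.indexSet ∧ (l, b) ∈ L.indexSet ∧ (b, j) ∈ L.indexSet := by
  obtain ⟨q, hi, hq⟩ := hij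
  obtain ⟨q', hl, hq'⟩ := hlj
  rcases le_total q q' with h | h
  · obtain ⟨b, hbk, h1, h2⟩ := hL.exists_ne (l := q') k
    exact ⟨b, hbk, ⟨q', hi.trans (L.row_strictMono.monotone h), h1⟩, ⟨q', hl, h1⟩, ⟨q', h2, hq'⟩⟩
  · obtain ⟨b, hbk, h1, h2⟩ := hL.exists_ne (l := q) k
    exact ⟨b, hbk, ⟨q, hi, h1⟩, ⟨q, hl.trans (L.row_strictMono.monotone h), h1⟩, ⟨q, h2, hq⟩⟩

/-- Supplies the base point from which the diagonal cocycle is integrated. -/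
theorem IsSDUT.exists_comparable (hL : L.IsSDUT) {p : Fin n × Fin n} (hp : p ∈ L.indexSet) :
    ∃ b, ∀ i, (i, b) ∈ L.indexSet ∨ (b, i) ∈ L.indexSet := by
  obtain ⟨l, -, -⟩ := hp
  refine ⟨L.col l, fun i => ?_⟩
  rcases le_total i (L.row l) with h | h
  · exact .inl ⟨l, h, le_rfl⟩
  · exact .inr ⟨l, (hL.1 l).le, (hL.1 l).le.trans h⟩

/-- The index `b` beyond the corner shows that this cut is not the excluded value n. -/
theorem mem_cuts_row (l : Fin L.step) {b : Fin n} (h : L.row l < b) :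
    (L.row l : ℕ) + 1 ∈ L.cuts := by
  rw [Fin.lt_def] at h
  simp only [cuts, Finset.mem_sdiff, Finset.mem_union, Finset.mem_image, Finset.mem_univ,
    true_and, Finset.mem_insert, Finset.mem_singleton]
  exact ⟨.inl ⟨l, rfl⟩, by omega⟩

theorem mem_cuts_col (l : Fin L.step) {b : Fin n} (h : b < L.col l) :
    (L.col l : ℕ) ∈ L.cuts := by
  rw [Fin.lt_def] at h
  simp only [cuts, Finset.mem_sdiff, Finset.mem_union, Finset.mem_image, Finset.mem_univ,
    true_and, Finset.mem_insert, Finset.mem_singleton]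
  exact ⟨.inr ⟨l, rfl⟩, by omega⟩

theorem blockIndex_lt_of_cut {a b : Fin n} {c : ℕ} (hc : c ∈ L.cuts) (ha : (a : ℕ) < c)
    (hb : c ≤ b) : L.blockIndex a < L.blockIndex b := by
  refine Finset.card_lt_card ((Finset.ssubset_iff_of_subset fun x hx => ?_).mpr ⟨c, ?_, ?_⟩)
  · rw [Finset.mem_filter] at hx ⊢
    exact ⟨hx.1, by omega⟩
  · exact Finset.mem_filter.mpr ⟨hc, hb⟩
  · rw [Finset.mem_filter]
    omega

/-- The partition cuts at both ends of [j_ℓ, i_ℓ], so no block straddles the boundary of that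
interval. -/
theorem mem_indexSet_of_blockIndex_eq {a b : Fin n} (ha : (a, a) ∈ L.indexSet)
    (hab : L.blockIndex a = L.blockIndex b) :
    (a, b) ∈ L.indexSet ∧ (b, a) ∈ L.indexSet := by
  obtain ⟨l, h1, h2⟩ := ha
  have h3 : L.col l ≤ b := by
    by_contra! h
    exact (blockIndex_lt_of_cut (mem_cuts_col l h) h h2).ne' hab
  have h4 : b ≤ L.row l := by
    by_contra! h
    exact (blockIndex_lt_of_cut (mem_cuts_row l h) (Nat.lt_succ_of_le h1) h).ne hab
  exact ⟨⟨l, h1, h3⟩, ⟨l, h4, h2⟩⟩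

/-! ### Generators of M_L^0 and of M_L. -/

variable {F : Type*} [Field F]

theorem single_mem_matrices {i j : Fin n} (hij : (i, j) ∈ L.indexSet) (c : F) :
    Matrix.single i j c ∈ L.matrices F := by
  rw [mem_matrices_iff]
  rintro k l hkl
  refine Matrix.single_apply_of_ne _ _ _ _ _ ?_
  rintro ⟨rfl, rfl⟩
  exact hkl hij

theorem single_mem_lieMatrices (h : L.IsUpperTriangular) {i j : Fin n}
    (hij : (i, j) ∈ L.indexSet) (c : F) : Matrix.single i j c ∈ L.lieMatrices F h :=
  single_mem_matrices hij c

theorem single_mem_lieMatricesZero (h : L.IsUpperTriangular) {i j : Fin n}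
    (hij : (i, j) ∈ L.indexSet) (hne : i ≠ j) (c : F) :
    Matrix.single i j c ∈ L.lieMatricesZero F h := by
  refine ⟨single_mem_matrices hij c, fun k => Finset.sum_eq_zero fun a _ => ?_⟩
  refine Matrix.single_apply_of_ne _ _ _ _ _ ?_
  rintro ⟨rfl, rfl⟩
  exact hne rfl

theorem lie_mem_lieMatricesZero (h : L.IsUpperTriangular) {A B : Matrix (Fin n) (Fin n) F}
    (hA : A ∈ L.lieMatrices F h) (hB : B ∈ L.lieMatrices F h) :
    ⁅A, B⁆ ∈ L.lieMatricesZero F h := by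
  refine ⟨(L.lieMatrices F h).lie_mem hA hB, fun k => ?_⟩
  have h1 : L.blockTrace k ⁅A, B⁆ = L.blockTrace k (A * B) - L.blockTrace k (B * A) :=
    Finset.sum_sub_distrib _ _
  rw [h1, blockTrace_mul_comm h k hA hB, sub_self]

theorem lie_single_single (i j : Fin n) :
    ⁅Matrix.single i j (1 : F), Matrix.single j i (1 : F)⁆ =
      Matrix.single i i 1 - Matrix.single j j 1 := by
  rw [Ring.lie_def, Matrix.single_mul_single_same, Matrix.single_mul_single_same, one_mul]

theorem lie_single_of_ne {i j m : Fin n} (hne : i ≠ m) :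
    ⁅Matrix.single i j (1 : F), Matrix.single j m (1 : F)⁆ = Matrix.single i m 1 := by
  rw [Ring.lie_def, Matrix.single_mul_single_same,
    Matrix.single_mul_single_of_ne _ _ _ _ hne.symm, one_mul, sub_zero]

theorem lie_single_of_ne_of_ne {i j k l : Fin n} (hjk : j ≠ k) (hli : l ≠ i) :
    ⁅Matrix.single i j (1 : F), Matrix.single k l (1 : F)⁆ = 0 := by
  rw [Ring.lie_def, Matrix.single_mul_single_of_ne _ _ _ _ hjk,
    Matrix.single_mul_single_of_ne _ _ _ _ hli, sub_zero]

/-- The diagonal of a matrix whose trace on each block vanishes is a combination of differences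
of diagonal matrix units belonging to the same block. -/
theorem lieMatricesZero_le_of_generators (h : L.IsUpperTriangular)
    (S : Submodule F (Matrix (Fin n) (Fin n) F))
    (h1 : ∀ i j, (i, j) ∈ L.indexSet → i ≠ j → Matrix.single i j 1 ∈ S)
    (h2 : ∀ i j, (i, j) ∈ L.indexSet → (j, i) ∈ L.indexSet → i ≠ j →
      Matrix.single i i 1 - Matrix.single j j 1 ∈ S) :
    (L.lieMatricesZero F h).toSubmodule ≤ S := by
  rintro A ⟨hA, hA'⟩
  rw [mem_lieMatrices_iff] at hA
  classical
  have hoff : A - Matrix.diagonal (fun i => A i i) ∈ S := by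
    rw [Matrix.matrix_eq_sum_single (A - _)]
    refine Submodule.sum_mem _ fun i _ => Submodule.sum_mem _ fun j _ => ?_
    rcases eq_or_ne i j with rfl | hij
    · rw [Matrix.sub_apply, Matrix.diagonal_apply_eq, sub_self, Matrix.single_zero]
      exact S.zero_mem
    · rw [Matrix.sub_apply, Matrix.diagonal_apply_ne _ hij, sub_zero]
      by_cases hI : (i, j) ∈ L.indexSet
      · have h3 := S.smul_mem (A i j) (h1 i j hI hij)
        rwa [Matrix.smul_single, smul_eq_mul, mul_one] at h3
      · rw [hA i j hI, Matrix.single_zero]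
        exact S.zero_mem
  have hdiag : Matrix.diagonal (fun i => A i i) ∈ S := by
    rw [← Matrix.sum_single_eq_diagonal,
      ← Finset.sum_fiberwise_of_maps_to (t := Finset.univ.image L.blockIndex)
        (g := L.blockIndex) (fun a ha => Finset.mem_image_of_mem _ ha)]
    refine Submodule.sum_mem _ fun k _ => ?_
    by_cases hk : ∃ b, L.blockIndex b = k ∧ (b, b) ∈ L.indexSet
    · obtain ⟨b, rfl, hb⟩ := hk
      -- The vanishing block trace allows the same E_bb to be subtracted from every E_aa of the
      -- block.
      have h3 : ∑ a with L.blockIndex a = L.blockIndex b, Matrix.single a a (A a a) =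
          ∑ a with L.blockIndex a = L.blockIndex b,
            A a a • (Matrix.single a a (1 : F) - Matrix.single b b 1) := by
        simp only [smul_sub, Finset.sum_sub_distrib]
        rw [← Finset.sum_smul]
        have h4 : ∑ a with L.blockIndex a = L.blockIndex b, A a a = 0 := hA' _
        rw [h4, zero_smul, sub_zero]
        simp [Matrix.smul_single]
      rw [h3]
      refine Submodule.sum_mem _ fun a ha => S.smul_mem _ ?_
      rw [Finset.mem_filter] at ha
      rcases eq_or_ne a b with rfl | hab
      · rw [sub_self]
        exact S.zero_mem
      · obtain ⟨h5, h6⟩ := mem_indexSet_of_blockIndex_eq hb ha.2.symm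
        exact h2 a b h6 h5 hab
    · refine Submodule.sum_mem _ fun a ha => ?_
      rw [Finset.mem_filter] at ha
      rw [hA a a fun haa => hk ⟨a, ha.2, haa⟩, Matrix.single_zero]
      exact S.zero_mem
  simpa using S.add_mem hoff hdiag

/-- Passing to associative products recovers the diagonal units, E_ii = E_ia E_ai, which Lie
brackets of off-diagonal units need not give. -/
theorem IsSDUT.lieMatrices_le_of_generators (hL : L.IsSDUT)
    (S : Subalgebra F (Matrix (Fin n) (Fin n) F))
    (h1 : ∀ i j, (i, j) ∈ L.indexSet → i ≠ j → Matrix.single i j 1 ∈ S) :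
    L.matrices F ≤ S.toSubmodule := by
  refine Submodule.span_le.mpr ?_
  rintro _ ⟨⟨i, j⟩, hp, rfl⟩
  rcases eq_or_ne i j with rfl | hij
  · obtain ⟨a, ha, h2, h3⟩ := hL.exists_equiv hp
    have := S.mul_mem (h1 i a h2 ha.symm) (h1 a i h3 ha)
    rwa [Matrix.single_mul_single_same, one_mul] at this
  · exact h1 i j hp hij

/-- A matrix that commutes with `M_L^0` commutes with `M_L`. -/
theorem IsSDUT.lie_eq_zero_of_forall_lieMatricesZero (hL : L.IsSDUT)
    {A : Matrix (Fin n) (Fin n) F}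
    (hA : ∀ B ∈ L.lieMatricesZero F hL.isUpperTriangular, ⁅A, B⁆ = 0)
    {B : Matrix (Fin n) (Fin n) F} (hB : B ∈ L.matrices F) : ⁅A, B⁆ = 0 := by
  -- The centralizer of A is an associative subalgebra, so it suffices that it contains the
  -- off-diagonal units.
  have h := hL.lieMatrices_le_of_generators (Subalgebra.centralizer F {A}) (fun i j hij hne => by
    rw [Subalgebra.mem_centralizer_iff]
    rintro _ rfl
    have := hA _ (single_mem_lieMatricesZero hL.isUpperTriangular hij hne 1)
    rwa [Ring.lie_def, sub_eq_zero] at this) hB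
  rw [Ring.lie_def, sub_eq_zero]
  exact Subalgebra.mem_centralizer_iff F |>.mp h A rfl

/-- The commutator with A is a derivation of the associative product, hence [A, E_ii] = [A, E_ia]
E_ai + E_ia [A, E_ai], and M_L is closed under multiplication. -/
theorem IsSDUT.lie_mem_matrices (hL : L.IsSDUT) {A : Matrix (Fin n) (Fin n) F}
    (hA : ∀ B ∈ L.lieMatricesZero F hL.isUpperTriangular, ⁅A, B⁆ ∈ L.matrices F)
    {B : Matrix (Fin n) (Fin n) F} (hB : B ∈ L.matrices F) : ⁅A, B⁆ ∈ L.matrices F := by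
  have h := hL.isUpperTriangular
  suffices L.matrices F ≤ (L.matrices F).comap (LieAlgebra.ad F (Matrix (Fin n) (Fin n) F) A) from
    this hB
  refine Submodule.span_le.mpr ?_
  rintro _ ⟨⟨i, j⟩, hp, rfl⟩
  show ⁅A, _⁆ ∈ L.matrices F
  rcases eq_or_ne i j with rfl | hij
  · obtain ⟨a, ha, h2, h3⟩ := hL.exists_equiv hp
    have h4 := hA _ (single_mem_lieMatricesZero h h2 ha.symm 1)
    have h5 := hA _ (single_mem_lieMatricesZero h h3 ha 1)
    have h6 := add_mem (mul_mem_matrices h h4 (single_mem_matrices h3 (1 : F)))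
      (mul_mem_matrices h (single_mem_matrices h2 (1 : F)) h5)
    have h7 : Matrix.single i i (1 : F) = Matrix.single i a 1 * Matrix.single a i 1 := by
      rw [Matrix.single_mul_single_same, one_mul]
    rw [h7]
    convert h6 using 1
    simp only [Ring.lie_def]
    noncomm_ring
  · exact hA _ (single_mem_lieMatricesZero h hp hij 1)

end Ladder

/-! ### Derivations as maps on matrices. -/

/-- A derivation of a Lie subalgebra of `M_n`, as a map on matrices (with value zero outside the
subalgebra). -/
noncomputable def LieDerivation.onMatrices {n : ℕ} {F : Type*} [Field F]
    {K : LieSubalgebra F (Matrix (Fin n) (Fin n) F)} (D : LieDerivation F K K)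
    (X : Matrix (Fin n) (Fin n) F) : Matrix (Fin n) (Fin n) F :=
  open Classical in if hX : X ∈ K then (D ⟨X, hX⟩ : K) else 0

namespace LieDerivation

variable {n : ℕ} {F : Type*} [Field F] {K : LieSubalgebra F (Matrix (Fin n) (Fin n) F)}
  (D : LieDerivation F K K)

theorem onMatrices_of_mem {X : Matrix (Fin n) (Fin n) F} (hX : X ∈ K) :
    D.onMatrices X = (D ⟨X, hX⟩ : K) := dif_pos hX

theorem onMatrices_mem (X : Matrix (Fin n) (Fin n) F) : D.onMatrices X ∈ K := by
  by_cases hX : X ∈ K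
  · rw [D.onMatrices_of_mem hX]
    exact (D ⟨X, hX⟩).2
  · rw [onMatrices, dif_neg hX]
    exact K.zero_mem

theorem onMatrices_lie {X Y : Matrix (Fin n) (Fin n) F} (hX : X ∈ K) (hY : Y ∈ K) :
    D.onMatrices ⁅X, Y⁆ = ⁅D.onMatrices X, Y⁆ + ⁅X, D.onMatrices Y⁆ := by
  rw [D.onMatrices_of_mem hX, D.onMatrices_of_mem hY, D.onMatrices_of_mem (K.lie_mem hX hY)]
  have h := congrArg (Subtype.val) (D.apply_lie_eq_add ⟨X, hX⟩ ⟨Y, hY⟩)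
  rw [add_comm]
  exact h

theorem onMatrices_smul (c : F) {X : Matrix (Fin n) (Fin n) F} (hX : X ∈ K) :
    D.onMatrices (c • X) = c • D.onMatrices X := by
  rw [D.onMatrices_of_mem hX, D.onMatrices_of_mem (K.smul_mem c hX)]
  exact congrArg (Subtype.val) (map_smul D c (⟨X, hX⟩ : K))

theorem onMatrices_zero : D.onMatrices 0 = 0 := by
  simpa using D.onMatrices_smul 0 K.zero_mem

end LieDerivation

/-! ### Support of the image of a matrix unit under a derivation of M_L^0. -/

namespace Ladder.IsSDUT

open Matrix LieDerivation

variable {n : ℕ} {L : Ladder n} {F : Type*} [Field F] (hL : L.IsSDUT)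
  (D : LieDerivation F (L.lieMatricesZero F hL.isUpperTriangular)
    (L.lieMatricesZero F hL.isUpperTriangular))

/-- The image of the matrix unit `E_{ij}` under a derivation of `M_L^0`. -/
noncomputable def img (i j : Fin n) : Matrix (Fin n) (Fin n) F := D.onMatrices (single i j 1)

/-- Leibniz rule for `E_{im} = [E_{ij}, E_{jm}]`. -/
theorem img_trans {i j m : Fin n} (hij : (i, j) ∈ L.indexSet) (hjm : (j, m) ∈ L.indexSet)
    (h1 : i ≠ j) (h2 : j ≠ m) (h3 : i ≠ m) (k l : Fin n) :
    hL.img D i m k l =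
      (if l = m then hL.img D i j k j else 0) - (if k = j then hL.img D i j m l else 0)
      + ((if k = i then hL.img D j m j l else 0) - (if l = j then hL.img D j m k i else 0)) := by
  have h := hL.isUpperTriangular
  have h4 := D.onMatrices_lie (single_mem_lieMatricesZero h hij h1 1)
    (single_mem_lieMatricesZero h hjm h2 1)
  rw [lie_single_of_ne h3] at h4
  have h5 := congrFun (congrFun h4 k) l
  simpa only [img, Ring.lie_def, Matrix.add_apply, Matrix.sub_apply, mul_single_one_apply,
    single_one_mul_apply] using h5

/-- Leibniz rule for `[E_{ij}, E_{pm}] = 0`. -/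
theorem img_comm {i j p m : Fin n} (hij : (i, j) ∈ L.indexSet) (hpm : (p, m) ∈ L.indexSet)
    (h1 : i ≠ j) (h2 : p ≠ m) (h3 : j ≠ p) (h4 : m ≠ i) (k l : Fin n) :
    (if l = m then hL.img D i j k p else 0) - (if k = p then hL.img D i j m l else 0)
      + ((if k = i then hL.img D p m j l else 0) - (if l = j then hL.img D p m k i else 0)) = 0 := by
  have h := hL.isUpperTriangular
  have h5 := D.onMatrices_lie (single_mem_lieMatricesZero h hij h1 1)
    (single_mem_lieMatricesZero h hpm h2 1)
  rw [lie_single_of_ne_of_ne h3 h4, D.onMatrices_zero] at h5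
  have h6 := congrFun (congrFun h5 k) l
  simpa only [img, Ring.lie_def, Matrix.zero_apply, Matrix.add_apply, Matrix.sub_apply, mul_single_one_apply,
    single_one_mul_apply] using h6.symm

theorem diag_mul_single (i j a : Fin n) :
    single a a (1 : F) * single i j (1 : F) = (if i = a then 1 else 0 : F) • single i j (1 : F) := by
  split_ifs with h
  · rw [h, single_mul_single_same, one_mul, one_smul]
  · rw [single_mul_single_of_ne _ _ _ _ (Ne.symm h), zero_smul]

theorem single_mul_diag (i j a : Fin n) :
    single i j (1 : F) * single a a (1 : F) = (if j = a then 1 else 0 : F) • single i j (1 : F) := by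
  split_ifs with h
  · rw [h, single_mul_single_same, one_mul, one_smul]
  · rw [single_mul_single_of_ne _ _ _ _ h, zero_smul]

theorem lie_diag_single (i j a b : Fin n) :
    ⁅single a a (1 : F) - single b b 1, single i j (1 : F)⁆ =
      (((if i = a then 1 else 0) - (if i = b then 1 else 0)) -
        ((if j = a then 1 else 0) - (if j = b then 1 else 0)) : F) • single i j (1 : F) := by
  rw [Ring.lie_def, Matrix.sub_mul, Matrix.mul_sub, diag_mul_single, diag_mul_single,
    single_mul_diag, single_mul_diag, ← sub_smul, ← sub_smul, ← sub_smul]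

/-- The weight of `E_{ij}` minus that of `E_{kl}`, at the place `a`. -/
def weightDiff (F : Type*) [Field F] (i j k l a : Fin n) : F :=
  (if i = a then 1 else 0) - (if j = a then 1 else 0) - (if k = a then 1 else 0)
    + (if l = a then 1 else 0)

/-- Apply D to [H, E_ij], where H = E_aa - E_bb = [E_ab, E_ba]. The unknown term [D H, E_ij] lives
in row i and column j, so at (k, l) only the weights of H remain. -/
theorem weightDiff_mul_img {i j k l a b : Fin n} (hij : (i, j) ∈ L.indexSet) (hne : i ≠ j)
    (hab : (a, b) ∈ L.indexSet) (hba : (b, a) ∈ L.indexSet) (hne' : a ≠ b) (hki : k ≠ i)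
    (hlj : l ≠ j) :
    (weightDiff F i j k l a - weightDiff F i j k l b) * hL.img D i j k l = 0 := by
  have h := hL.isUpperTriangular
  have h0 := (L.lieMatricesZero F h).lie_mem (single_mem_lieMatricesZero h hab hne' (1 : F))
    (single_mem_lieMatricesZero h hba hne'.symm (1 : F))
  have h1 := D.onMatrices_lie h0 (single_mem_lieMatricesZero h hij hne (1 : F))
  rw [lie_single_single, lie_diag_single,
    D.onMatrices_smul _ (single_mem_lieMatricesZero h hij hne (1 : F))] at h1
  have h2 := congrFun (congrFun h1 k) l
  simp only [Ring.lie_def, Matrix.add_apply, Matrix.sub_apply, mul_single_one_apply,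
    single_one_mul_apply, Matrix.smul_apply, Matrix.mul_sub, Matrix.sub_mul, if_neg hki,
    if_neg hlj, smul_eq_mul] at h2
  change _ * hL.img D i j k l = _ - _ + ((_ - _) - (_ - _)) at h2
  have h3 : ∀ p q : Fin n, D.onMatrices (single i j 1) p q = hL.img D i j p q := fun _ _ => rfl
  simp only [h3] at h2
  have e1 : ∀ c, (if k = c then hL.img D i j c l else 0) =
      (if k = c then 1 else 0) * hL.img D i j k l := by
    intro c; split_ifs with hc
    · rw [hc, one_mul]
    · rw [zero_mul]
  have e2 : ∀ c, (if l = c then hL.img D i j k c else 0) =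
      (if l = c then 1 else 0) * hL.img D i j k l := by
    intro c; split_ifs with hc
    · rw [hc, one_mul]
    · rw [zero_mul]
  rw [e1, e1, e2, e2] at h2
  rw [weightDiff, weightDiff]
  linear_combination h2

theorem img_eq_zero_of_row (h2F : (2 : F) ≠ 0) (h3F : (3 : F) ≠ 0) {i j k l : Fin n}
    (hij : (i, j) ∈ L.indexSet) (hne : i ≠ j)
    (hki : k ≠ i) (hlj : l ≠ j) (hi : (i, i) ∈ L.indexSet) : hL.img D i j k l = 0 := by
  by_contra hd
  obtain ⟨a, hai, hia, hai'⟩ := hL.exists_equiv hi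
  have hw := (mul_eq_zero.mp (hL.weightDiff_mul_img D hij hne hia hai' hai.symm hki hlj)
    ).resolve_right hd
  have h4F : (4 : F) ≠ 0 := by
    have : (4 : F) = 2 * 2 := by norm_num
    rw [this]; exact mul_ne_zero h2F h2F
  -- `hw` says 1 + [l = i] + [j = a] + [k = a] - [l = a] = 0. The left side is an integer from 0 to
  -- 4; as 2 and 3 are invertible it must be 0 itself, which leaves this case alone.
  have hal : l = a ∧ k ≠ a := by
    simp only [weightDiff, if_true, if_neg hne.symm, if_neg hki, if_neg hai.symm] at hw
    by_contra hcon
    split_ifs at hw <;> first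
      | exact one_ne_zero (α := F) (by linear_combination hw)
      | exact h2F (by linear_combination hw)
      | exact h3F (by linear_combination hw)
      | exact h4F (by linear_combination hw)
      | (clear hw hd; grind)
  obtain ⟨rfl, hkl⟩ := hal
  -- From [E_ij, E_lj] = 0 the (k, l) entry of D(E_ij) equals the (k, i) entry of D(E_lj); from E_lj
  -- = [E_li, E_ij] the two are opposite. Hence twice the entry is zero.
  have h1 := hL.img_comm D hij (hL.isUpperTriangular.indexSet_trans hai' hij) hne hlj hlj.symm
    hne.symm k j
  have h2 := hL.img_trans D hai' hij hai hne hlj k i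
  simp only [if_true, if_neg hki, if_neg hkl, if_neg hne] at h1 h2
  exact hd ((mul_eq_zero.mp (by linear_combination h1 + h2 :
    2 * hL.img D i j k l = 0)).resolve_left h2F)

theorem img_eq_zero_of_col (h2F : (2 : F) ≠ 0) (h3F : (3 : F) ≠ 0) {i j k l : Fin n}
    (hij : (i, j) ∈ L.indexSet) (hne : i ≠ j)
    (hki : k ≠ i) (hlj : l ≠ j) (hj : (j, j) ∈ L.indexSet) : hL.img D i j k l = 0 := by
  by_contra hd
  obtain ⟨a, haj, hja, haj'⟩ := hL.exists_equiv hj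
  have hw := (mul_eq_zero.mp (hL.weightDiff_mul_img D hij hne hja haj' haj.symm hki hlj)
    ).resolve_right hd
  have h4F : (4 : F) ≠ 0 := by
    have : (4 : F) = 2 * 2 := by norm_num
    rw [this]; exact mul_ne_zero h2F h2F
  -- The transposed argument: the surviving weight case is closed by E_ik, which commutes with E_ij
  -- and equals [E_ij, E_jk].
  have hal : k = a ∧ l ≠ a := by
    simp only [weightDiff, if_true, if_neg hne, if_neg hlj, if_neg haj.symm] at hw
    by_contra hcon
    split_ifs at hw <;> first
      | exact one_ne_zero (α := F) (by linear_combination hw)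
      | exact one_ne_zero (α := F) (by linear_combination -hw)
      | exact h2F (by linear_combination -hw)
      | exact h3F (by linear_combination -hw)
      | exact h4F (by linear_combination -hw)
      | (clear hw hd; grind)
  obtain ⟨rfl, hlk⟩ := hal
  have h1 := hL.img_comm D hij (hL.isUpperTriangular.indexSet_trans hij hja) hne hki.symm hne.symm
    hki i l
  have h2 := hL.img_trans D hij hja hne haj.symm hki.symm j l
  simp only [if_true, if_neg hlk, if_neg hlj, if_neg hne.symm] at h1 h2
  exact hd ((mul_eq_zero.mp (by linear_combination h2 - h1 :
    2 * hL.img D i j k l = 0)).resolve_left h2F)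

/-- The image of `E_{ij}` is supported on row `i` and column `j`. -/
theorem img_eq_zero (h2F : (2 : F) ≠ 0) (h3F : (3 : F) ≠ 0) {i j k l : Fin n}
    (hij : (i, j) ∈ L.indexSet) (hne : i ≠ j) (hki : k ≠ i) (hlj : l ≠ j) :
    hL.img D i j k l = 0 := by
  by_cases hi : (i, i) ∈ L.indexSet
  · exact hL.img_eq_zero_of_row D h2F h3F hij hne hki hlj hi
  by_cases hj : (j, j) ∈ L.indexSet
  · exact hL.img_eq_zero_of_col D h2F h3F hij hne hki hlj hj
  -- With neither end on the diagonal of I(L), factor E_ij = [E_ib, E_bj] through a diagonal b ≠ k;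
  -- the one term that can remain is an entry of D(E_bj), killed by the row case.
  obtain ⟨b, hbk, hib, hbj, hbb⟩ := hL.exists_between hij k
  have hbi : b ≠ i := by rintro rfl; exact hi hbb
  have hbj' : b ≠ j := by rintro rfl; exact hj hbb
  rw [hL.img_trans D hib hbj hbi.symm hbj' hne, if_neg hlj, if_neg hbk.symm, if_neg hki,
    hL.img_eq_zero_of_row D h2F h3F hbj hbj' hbk.symm hne hbb]
  simp

end Ladder.IsSDUT

/-! ### Derivations of M_L^0 are commutators with matrices. -/

namespace Ladder.IsSDUT

open Matrix LieDerivation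

variable {n : ℕ} {L : Ladder n} {F : Type*} [Field F] (hL : L.IsSDUT)
  (D : LieDerivation F (L.lieMatricesZero F hL.isUpperTriangular)
    (L.lieMatricesZero F hL.isUpperTriangular))

/-- The common value is the future entry A_ki. Two columns j and m are compared through a column b
that factors both E_ij and E_im. -/
theorem img_col_eq (h2F : (2 : F) ≠ 0) (h3F : (3 : F) ≠ 0) {i j m k : Fin n}
    (hij : (i, j) ∈ L.indexSet) (him : (i, m) ∈ L.indexSet) (hj : i ≠ j) (hm : i ≠ m)
    (hk : k ≠ i) : hL.img D i j k j = hL.img D i m k m := by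
  have step : ∀ b m, (i, b) ∈ L.indexSet → (b, m) ∈ L.indexSet → i ≠ b → i ≠ m →
      hL.img D i b k b = hL.img D i m k m := by
    intro b m hib hbm h1 h2
    rcases eq_or_ne b m with rfl | h3
    · rfl
    rw [hL.img_trans D hib hbm h1 h3 h2 k m, if_pos rfl, if_neg hk, if_neg h3.symm,
      hL.img_eq_zero D h2F h3F hib h1 h2.symm h3.symm]
    simp
  obtain ⟨b, hbi, hib, hbj, hbm⟩ := hL.exists_common_col hij him i
  rw [← step b j hib hbj hbi.symm hj, step b m hib hbm hbi.symm hm]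

theorem img_row_eq (h2F : (2 : F) ≠ 0) (h3F : (3 : F) ≠ 0) {i l j k : Fin n}
    (hij : (i, j) ∈ L.indexSet) (hlj : (l, j) ∈ L.indexSet) (hi : i ≠ j) (hl : l ≠ j)
    (hk : k ≠ j) : hL.img D i j i k = hL.img D l j l k := by
  have step : ∀ l b, (l, b) ∈ L.indexSet → (b, j) ∈ L.indexSet → b ≠ j → l ≠ j →
      hL.img D b j b k = hL.img D l j l k := by
    intro l b hlb hbj h1 h2
    rcases eq_or_ne l b with rfl | h3
    · rfl
    rw [hL.img_trans D hlb hbj h3 h1 h2 l k, if_neg hk, if_neg h3, if_pos rfl,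
      hL.img_eq_zero D h2F h3F hbj h1 h3 h2]
    simp
  obtain ⟨b, hbj, hib, hlb, hbj'⟩ := hL.exists_common_row hij hlj j
  rw [← step i b hib hbj' hbj hi, step l b hlb hbj' hbj hl]

/-- Only the places i and k of the diagonal can be nonzero, and block traces vanish. If i and k lie
in different blocks, both entries are zero. -/
theorem img_diag (h2F : (2 : F) ≠ 0) (h3F : (3 : F) ≠ 0) {i k : Fin n}
    (hik : (i, k) ∈ L.indexSet) (hne : i ≠ k) :
    hL.img D i k k k = - hL.img D i k i i := by
  have htr := fun q => (D.onMatrices_mem (single i k (1 : F))).2 q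
  change ∀ q, ∑ a with L.blockIndex a = q, hL.img D i k a a = 0 at htr
  have hz : ∀ a, a ≠ i → a ≠ k → hL.img D i k a a = 0 := fun a h1 h2 =>
    hL.img_eq_zero D h2F h3F hik hne h1 h2
  by_cases hb : L.blockIndex i = L.blockIndex k
  · have h1 := htr (L.blockIndex k)
    rw [← Finset.sum_subset (s₁ := {i, k}), Finset.sum_pair hne] at h1
    · linear_combination h1
    · intro x hx
      simp only [Finset.mem_insert, Finset.mem_singleton] at hx
      rcases hx with rfl | rfl <;> simp [hb]
    · intro x _ hx
      simp only [Finset.mem_insert, Finset.mem_singleton, not_or] at hx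
      exact hz x hx.1 hx.2
  · have h1 := htr (L.blockIndex k)
    have h2 := htr (L.blockIndex i)
    rw [Finset.sum_eq_single_of_mem k (by simp)] at h1
    · rw [Finset.sum_eq_single_of_mem i (by simp)] at h2
      · rw [h1, h2, neg_zero]
      · intro a ha hai
        refine hz a hai ?_
        rintro rfl
        exact hb (Finset.mem_filter.mp ha).2.symm
    · intro a ha hak
      refine hz a ?_ hak
      rintro rfl
      exact hb (Finset.mem_filter.mp ha).2

/-- Column and row readings of A_ki agree. If (i, k) is in I(L), both are compared with the diagonal
of D(E_ik); otherwise E_lk and E_ij commute and the (l, j) entry of the Leibniz rule gives the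
relation. -/
theorem img_col_eq_neg_row (h2F : (2 : F) ≠ 0) (h3F : (3 : F) ≠ 0) {i j l k : Fin n}
    (hij : (i, j) ∈ L.indexSet) (hlk : (l, k) ∈ L.indexSet) (hj : i ≠ j) (hl : l ≠ k)
    (hk : k ≠ i) : hL.img D i j k j = - hL.img D l k l i := by
  have viaDiag : (i, k) ∈ L.indexSet → hL.img D i j k j = - hL.img D l k l i := fun hik => by
    rw [hL.img_col_eq D h2F h3F hij hik hj hk.symm hk, hL.img_diag D h2F h3F hik hk.symm,
      hL.img_row_eq D h2F h3F hik hlk hk.symm hl hk.symm]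
  rcases eq_or_ne l i with rfl | hli
  · exact viaDiag hlk
  rcases eq_or_ne j k with rfl | hjk
  · exact viaDiag hij
  rcases eq_or_ne l j with rfl | hlj
  · exact viaDiag (hL.isUpperTriangular.indexSet_trans hij hlk)
  have h1 := hL.img_comm D hlk hij hl hj hk hlj.symm l j
  simp only [if_true, if_neg hli, if_neg hjk] at h1
  linear_combination h1

/-- The diagonal coefficient of a derivation of `M_L^0` at `E_{ij}`. -/
noncomputable def coeff (i j : Fin n) : F := if i = j then 0 else hL.img D i j i j

/-- Follows from [[E_ij, E_ji], E_ij] = 2 E_ij by comparing (i, j) entries; the relation E_ii = E_ij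
E_ji is not available as a bracket. -/
theorem coeff_add_swap (h2F : (2 : F) ≠ 0) {i j : Fin n} (hij : (i, j) ∈ L.indexSet)
    (hji : (j, i) ∈ L.indexSet) (hne : i ≠ j) : hL.img D i j i j + hL.img D j i j i = 0 := by
  have h := hL.isUpperTriangular
  have hi := single_mem_lieMatricesZero h hij hne (1 : F)
  have hj := single_mem_lieMatricesZero h hji hne.symm (1 : F)
  have h1 := D.onMatrices_lie ((L.lieMatricesZero F h).lie_mem hi hj) hi
  rw [D.onMatrices_lie hi hj, lie_single_single, lie_diag_single, D.onMatrices_smul _ hi] at h1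
  have h2 := congrFun (congrFun h1 i) j
  change (_ : F) • hL.img D i j i j = _ at h2
  have h3 : ∀ p q : Fin n, D.onMatrices (single i j 1) p q = hL.img D i j p q := fun _ _ => rfl
  have h4 : ∀ p q : Fin n, D.onMatrices (single j i 1) p q = hL.img D j i p q := fun _ _ => rfl
  simp only [Ring.lie_def, Matrix.add_apply, Matrix.sub_apply, mul_single_one_apply,
    single_one_mul_apply, Matrix.mul_sub, Matrix.sub_mul, h3, h4, if_true,
    if_neg hne, if_neg hne.symm, smul_eq_mul] at h2
  refine (mul_eq_zero.mp (?_ : (2 : F) * _ = 0)).resolve_left h2F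
  linear_combination -h2

theorem coeff_add (h2F : (2 : F) ≠ 0) {i j m : Fin n} (hij : (i, j) ∈ L.indexSet)
    (hjm : (j, m) ∈ L.indexSet) :
    hL.coeff D i j + hL.coeff D j m = hL.coeff D i m := by
  simp only [coeff]
  rcases eq_or_ne i j with rfl | h1
  · simp
  rcases eq_or_ne j m with rfl | h2
  · simp
  rcases eq_or_ne i m with rfl | h3
  · rw [if_neg h1, if_neg h2, if_pos rfl]
    exact hL.coeff_add_swap D h2F hij hjm h1
  rw [if_neg h1, if_neg h2, if_neg h3, hL.img_trans D hij hjm h1 h2 h3 i m]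
  simp [h1, h2.symm]

/-- The cocycle is integrated from an index b comparable with every other one; a_i is the
coefficient from i to b, or minus the one from b to i. -/
theorem exists_coeff_eq_sub (h2F : (2 : F) ≠ 0) :
    ∃ a : Fin n → F, ∀ i j, (i, j) ∈ L.indexSet → hL.coeff D i j = a i - a j := by
  by_cases hne : ∃ p, p ∈ L.indexSet
  swap
  · exact ⟨0, fun i j hij => absurd ⟨_, hij⟩ hne⟩
  obtain ⟨p, hp⟩ := hne
  obtain ⟨b, hb⟩ := hL.exists_comparable hp
  classical
  have h := hL.isUpperTriangular
  have key : ∀ i j m, (i, j) ∈ L.indexSet → (j, m) ∈ L.indexSet →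
    hL.coeff D i j + hL.coeff D j m = hL.coeff D i m := fun i j m => hL.coeff_add D h2F
  have hself : ∀ i, hL.coeff D i i = 0 := fun i => if_pos rfl
  refine ⟨fun i => if (i, b) ∈ L.indexSet then hL.coeff D i b else - hL.coeff D b i, ?_⟩
  intro i j hij
  by_cases hj : (j, b) ∈ L.indexSet
  · have hi := h.indexSet_trans hij hj
    simp only [if_pos hi, if_pos hj]
    linear_combination key i j b hij hj
  · have hbj := (hb j).resolve_left hj
    by_cases hi : (i, b) ∈ L.indexSet
    · simp only [if_pos hi, if_neg hj]
      linear_combination -key i b j hi hbj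
    · have hbi := (hb i).resolve_left hi
      simp only [if_neg hi, if_neg hj]
      linear_combination key b i j hbi hij

theorem exists_matrix_img (h2F : (2 : F) ≠ 0) (h3F : (3 : F) ≠ 0) :
    ∃ A : Matrix (Fin n) (Fin n) F, ∀ i j, (i, j) ∈ L.indexSet → i ≠ j →
      hL.img D i j = ⁅A, single i j (1 : F)⁆ := by
  obtain ⟨a, ha⟩ := hL.exists_coeff_eq_sub D h2F
  -- Here `x` is A_ki, taken from a column reading if there is one, otherwise from a row reading,
  -- and set to 0 if no unit detects it.
  have hoff : ∀ k i, ∃ x : F, k ≠ i →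
      (∀ j, (i, j) ∈ L.indexSet → i ≠ j → hL.img D i j k j = x) ∧
      (∀ l, (l, k) ∈ L.indexSet → l ≠ k → hL.img D l k l i = -x) := by
    intro k i
    by_cases hc : ∃ j, (i, j) ∈ L.indexSet ∧ i ≠ j
    · obtain ⟨j, hij, hj⟩ := hc
      refine ⟨hL.img D i j k j, fun hki => ⟨fun m him hm => ?_, fun l hlk hl => ?_⟩⟩
      · exact hL.img_col_eq D h2F h3F him hij hm hj hki
      · rw [hL.img_col_eq_neg_row D h2F h3F hij hlk hj hl hki, neg_neg]
    by_cases hr : ∃ l, (l, k) ∈ L.indexSet ∧ l ≠ k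
    · obtain ⟨l, hlk, hl⟩ := hr
      refine ⟨-hL.img D l k l i, fun hki => ⟨fun m him hm => absurd ⟨m, him, hm⟩ hc,
        fun q hqk hq => ?_⟩⟩
      rw [neg_neg]
      exact hL.img_row_eq D h2F h3F hqk hlk hq hl hki.symm
    · exact ⟨0, fun _ => ⟨fun m him hm => absurd ⟨m, him, hm⟩ hc,
        fun q hqk hq => absurd ⟨q, hqk, hq⟩ hr⟩⟩
  choose x hx using hoff
  refine ⟨Matrix.of fun k i => if k = i then a i else x k i, fun i j hij hne => ?_⟩
  ext k l
  rw [Ring.lie_def, Matrix.sub_apply, mul_single_one_apply, single_one_mul_apply]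
  simp only [Matrix.of_apply]
  rcases eq_or_ne k i with rfl | hki
  · rcases eq_or_ne l j with rfl | hlj
    · have := ha k l hij
      rw [coeff, if_neg hne] at this
      simpa using this
    · rw [(hx j l hlj.symm).2 k hij hne]
      simp [hlj, hlj.symm]
  · rcases eq_or_ne l j with rfl | hlj
    · rw [(hx k i hki).1 l hij hne]
      simp [hki]
    · rw [hL.img_eq_zero D h2F h3F hij hne hki hlj]
      simp [hki, hlj]

/-- Every derivation of `M_L^0` is the commutator with some matrix. -/
theorem exists_matrix (h2F : (2 : F) ≠ 0) (h3F : (3 : F) ≠ 0) :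
    ∃ A : Matrix (Fin n) (Fin n) F, ∀ X : L.lieMatricesZero F hL.isUpperTriangular,
      ((D X : L.lieMatricesZero F hL.isUpperTriangular) : Matrix (Fin n) (Fin n) F) =
        ⁅A, (X : Matrix (Fin n) (Fin n) F)⁆ := by
  have h := hL.isUpperTriangular
  obtain ⟨A, hA⟩ := hL.exists_matrix_img D h2F h3F
  refine ⟨A, ?_⟩
  -- The kernel of D - ad A is where the two maps agree. It contains the off-diagonal units, and the
  -- differences E_ii - E_jj because both maps obey the Leibniz rule.
  let T : L.lieMatricesZero F h →ₗ[F] Matrix (Fin n) (Fin n) F :=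
    (L.lieMatricesZero F h).toSubmodule.subtype ∘ₗ D.toLinearMap -
      (LieAlgebra.ad F (Matrix (Fin n) (Fin n) F) A : _ →ₗ[F] _) ∘ₗ
        (L.lieMatricesZero F h).toSubmodule.subtype
  have hT : ∀ (X : Matrix (Fin n) (Fin n) F) (hX : X ∈ L.lieMatricesZero F h),
      X ∈ (LinearMap.ker T).map (L.lieMatricesZero F h).toSubmodule.subtype ↔
        D.onMatrices X = ⁅A, X⁆ := by
    intro X hX
    rw [D.onMatrices_of_mem hX, ← sub_eq_zero]
    constructor
    · rintro ⟨Y, hY, rfl⟩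
      exact hY
    · intro hXT
      exact ⟨⟨X, hX⟩, hXT, rfl⟩
  have hS := lieMatricesZero_le_of_generators (F := F) h
    ((LinearMap.ker T).map (L.lieMatricesZero F h).toSubmodule.subtype) ?_ ?_
  · rintro ⟨X, hX⟩
    have := (hT X hX).mp (hS hX)
    rwa [D.onMatrices_of_mem hX] at this
  · intro i j hij hne
    exact (hT _ (single_mem_lieMatricesZero h hij hne 1)).mpr (hA i j hij hne)
  · intro i j hij hji hne
    have h1 := single_mem_lieMatricesZero h hij hne (1 : F)
    have h2 := single_mem_lieMatricesZero h hji hne.symm (1 : F)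
    rw [← lie_single_single]
    refine (hT _ ((L.lieMatricesZero F h).lie_mem h1 h2)).mpr ?_
    have h3 : D.onMatrices (single i j 1) = _ := hA i j hij hne
    have h4 : D.onMatrices (single j i 1) = _ := hA j i hji hne.symm
    rw [D.onMatrices_lie h1 h2, h3, h4, leibniz_lie A]

end Ladder.IsSDUT

/-! ### The derived algebra, restriction of derivations, and the splitting. -/

namespace Ladder.IsSDUT

open Matrix

variable {n : ℕ} {L : Ladder n} {F : Type*} [Field F] (hL : L.IsSDUT)

/-- Together with `derived_le_lieMatricesZero` this gives M_L^0 = [M_L, M_L]. In E_ij = [E_ib, E_bj]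
the index b may equal j, since E_jj is then allowed in M_L. -/
theorem lieMatricesZero_le_derived
    {X : L.lieMatrices F hL.isUpperTriangular}
    (hX : X.1 ∈ L.lieMatricesZero F hL.isUpperTriangular) :
    X ∈ (⁅(⊤ : LieIdeal F (L.lieMatrices F hL.isUpperTriangular)),
      (⊤ : LieIdeal F (L.lieMatrices F hL.isUpperTriangular))⁆ :
        LieIdeal F (L.lieMatrices F hL.isUpperTriangular)) := by
  have h := hL.isUpperTriangular
  have hlie : ∀ {A B : Matrix (Fin n) (Fin n) F}, A ∈ L.lieMatrices F h → B ∈ L.lieMatrices F h →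
      ⁅A, B⁆ ∈ (⁅(⊤ : LieIdeal F (L.lieMatrices F h)), (⊤ : LieIdeal F (L.lieMatrices F h))⁆ :
        LieIdeal F (L.lieMatrices F h)).toSubmodule.map
          (L.lieMatrices F h).toSubmodule.subtype := fun {A B} hA hB =>
    ⟨⁅(⟨A, hA⟩ : L.lieMatrices F h), (⟨B, hB⟩ : L.lieMatrices F h)⁆,
      LieSubmodule.lie_mem_lie (LieSubmodule.mem_top _) (LieSubmodule.mem_top _), rfl⟩
  obtain ⟨Y, hY, hYX⟩ := lieMatricesZero_le_of_generators (F := F) h _ (fun i j hij hne => by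
      obtain ⟨b, -, hib, hbj, hbb⟩ := hL.exists_between hij i
      have := hlie (single_mem_lieMatrices (F := F) h hib 1) (single_mem_lieMatrices h hbj 1)
      rwa [lie_single_of_ne hne] at this) (fun i j hij hji hne => by
      rw [← lie_single_single]
      exact hlie (single_mem_lieMatrices h hij 1) (single_mem_lieMatrices h hji 1)) hX
  rwa [← Subtype.ext hYX]

theorem derived_le_lieMatricesZero {X : L.lieMatrices F hL.isUpperTriangular}
    (hX : X ∈ (⁅(⊤ : LieIdeal F (L.lieMatrices F hL.isUpperTriangular)),
      (⊤ : LieIdeal F (L.lieMatrices F hL.isUpperTriangular))⁆ :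
        LieIdeal F (L.lieMatrices F hL.isUpperTriangular))) :
    X.1 ∈ L.lieMatricesZero F hL.isUpperTriangular := by
  have h := hL.isUpperTriangular
  rw [← LieSubmodule.mem_toSubmodule, LieSubmodule.lieIdeal_oper_eq_linear_span'] at hX
  suffices Submodule.span F _ ≤ (L.lieMatricesZero F h).toSubmodule.comap
    (L.lieMatrices F h).toSubmodule.subtype from this hX
  refine Submodule.span_le.mpr ?_
  rintro _ ⟨A, -, B, -, rfl⟩
  exact lie_mem_lieMatricesZero h A.2 B.2

theorem derivation_mem_lieMatricesZero
    (f : LieDerivation F (L.lieMatrices F hL.isUpperTriangular)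
      (L.lieMatrices F hL.isUpperTriangular)) {X : L.lieMatrices F hL.isUpperTriangular}
    (hX : X.1 ∈ L.lieMatricesZero F hL.isUpperTriangular) :
    (f X).1 ∈ L.lieMatricesZero F hL.isUpperTriangular := by
  have h := hL.isUpperTriangular
  have hX' := hL.lieMatricesZero_le_derived hX
  rw [← LieSubmodule.mem_toSubmodule, LieSubmodule.lieIdeal_oper_eq_linear_span'] at hX'
  suffices Submodule.span F _ ≤ ((L.lieMatricesZero F h).toSubmodule.comap
    (L.lieMatrices F h).toSubmodule.subtype).comap f.toLinearMap from this hX'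
  refine Submodule.span_le.mpr ?_
  rintro _ ⟨A, -, B, -, rfl⟩
  change (f ⁅A, B⁆).1 ∈ L.lieMatricesZero F h
  rw [f.apply_lie_eq_add]
  exact add_mem (lie_mem_lieMatricesZero h A.2 (f B).2) (lie_mem_lieMatricesZero h (f A).2 B.2)

/-- The restriction of derivations of `M_L` to `M_L^0`. -/
def restrict : LieDerivation F (L.lieMatrices F hL.isUpperTriangular)
      (L.lieMatrices F hL.isUpperTriangular) →ₗ⁅F⁆
    LieDerivation F (L.lieMatricesZero F hL.isUpperTriangular)
      (L.lieMatricesZero F hL.isUpperTriangular) where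
  toFun f :=
    { toFun A := ⟨(f ⟨A.1, A.2.1⟩).1, hL.derivation_mem_lieMatricesZero f A.2⟩
      map_add' A B := Subtype.ext <| by
        have h := congrArg Subtype.val (map_add f ⟨A.1, A.2.1⟩ ⟨B.1, B.2.1⟩)
        exact h
      map_smul' c A := Subtype.ext <| by
        have h := congrArg Subtype.val (map_smul f c ⟨A.1, A.2.1⟩)
        exact h
      leibniz' A B := Subtype.ext <| by
        have h := congrArg Subtype.val (f.apply_lie_eq_sub ⟨A.1, A.2.1⟩ ⟨B.1, B.2.1⟩)
        exact h }
  map_add' _ _ := rfl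
  map_smul' _ _ := rfl
  map_lie' {f g} := LieDerivation.ext fun A => Subtype.ext <| by
    rw [LieDerivation.commutator_apply]
    have h := congrArg Subtype.val
      (LieDerivation.commutator_apply (D1 := f) (D2 := g) ⟨A.1, A.2.1⟩)
    exact h

theorem centralMaps_apply_lie (φ : centralMaps (L.lieMatrices F hL.isUpperTriangular))
    (A B : L.lieMatrices F hL.isUpperTriangular) : ⁅φ.1 A, B⁆ = 0 :=
  Subtype.ext ((φ.2.2 ⟨_, ⟨A, rfl⟩, rfl⟩).1 B B.2)

/-- The inclusion of the central maps in the derivations of `M_L`. -/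
def centralInclusion : centralMaps (L.lieMatrices F hL.isUpperTriangular) →ₗ⁅F⁆
    LieDerivation F (L.lieMatrices F hL.isUpperTriangular)
      (L.lieMatrices F hL.isUpperTriangular) where
  toFun φ :=
    { φ.1 with
      leibniz' A B := by
        have h1 : φ.1 ⁅A, B⁆ = 0 :=
          φ.2.1 (LieSubmodule.lie_mem_lie (LieSubmodule.mem_top A) (LieSubmodule.mem_top B))
        have h2 : ⁅A, φ.1 B⁆ = 0 := by
          rw [← lie_skew, hL.centralMaps_apply_lie, neg_zero]
        have h3 : ⁅B, φ.1 A⁆ = 0 := by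
          rw [← lie_skew, hL.centralMaps_apply_lie, neg_zero]
        change φ.1 ⁅A, B⁆ = ⁅A, φ.1 B⁆ - ⁅B, φ.1 A⁆
        rw [h1, h2, h3, sub_zero] }
  map_add' _ _ := rfl
  map_smul' _ _ := rfl
  map_lie' {φ ψ} := LieDerivation.ext fun A => by
    rw [LieDerivation.commutator_apply]
    rfl

theorem range_centralInclusion :
    (hL.centralInclusion (F := F)).range = (hL.restrict (F := F)).ker := by
  ext f
  constructor
  · rintro ⟨φ, rfl⟩
    refine LieDerivation.ext fun A => Subtype.ext ?_
    have h1 : φ.1 ⟨A.1, A.2.1⟩ = 0 := φ.2.1 (hL.lieMatricesZero_le_derived A.2)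
    have h2 := congrArg Subtype.val h1
    exact h2
  · intro hf
    have hf0 : ∀ X : L.lieMatrices F hL.isUpperTriangular,
        X.1 ∈ L.lieMatricesZero F hL.isUpperTriangular → f X = 0 := fun X hX => by
      have h1 := congrArg Subtype.val (LieDerivation.congr_fun hf ⟨X.1, hX⟩)
      exact Subtype.ext h1
    refine ⟨⟨f.toLinearMap, fun X hX => hf0 X (hL.derived_le_lieMatricesZero hX), ?_⟩, rfl⟩
    rintro _ ⟨_, ⟨X, rfl⟩, rfl⟩
    refine ⟨fun B hB => ?_, (f X).2⟩
    refine hL.lie_eq_zero_of_forall_lieMatricesZero (fun C hC => ?_) hB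
    -- Both [X, C] and C lie in M_L^0, where f vanishes, so the Leibniz rule leaves [f X, C] = 0.
    have h1 := f.apply_lie_eq_add X ⟨C, hC.1⟩
    rw [hf0 _ (lie_mem_lieMatricesZero hL.isUpperTriangular X.2 hC.1), hf0 ⟨C, hC.1⟩ hC,
      lie_zero, zero_add] at h1
    exact (congrArg Subtype.val h1).symm

/-- The derivation of `M_L` given by the commutator with a matrix that maps `M_L^0` to `M_L`. -/
def adDerivation (A : Matrix (Fin n) (Fin n) F)
    (hA : ∀ B ∈ L.lieMatricesZero F hL.isUpperTriangular, ⁅A, B⁆ ∈ L.matrices F) :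
    LieDerivation F (L.lieMatrices F hL.isUpperTriangular)
      (L.lieMatrices F hL.isUpperTriangular) where
  toFun B := ⟨⁅A, B.1⁆, hL.lie_mem_matrices hA B.2⟩
  map_add' _ _ := Subtype.ext (lie_add _ _ _)
  map_smul' _ _ := Subtype.ext (lie_smul _ _ _)
  leibniz' B C := Subtype.ext <| by
    change ⁅A, ⁅B.1, C.1⁆⁆ = ⁅B.1, ⁅A, C.1⁆⁆ - ⁅C.1, ⁅A, B.1⁆⁆
    rw [leibniz_lie, ← lie_skew C.1]
    abel

/-- Every derivation of `M_L^0` extends to `M_L`, in a way that is compatible with brackets. -/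
theorem exists_splitting (h2F : (2 : F) ≠ 0) (h3F : (3 : F) ≠ 0) :
    ∃ σ : LieDerivation F (L.lieMatricesZero F hL.isUpperTriangular)
        (L.lieMatricesZero F hL.isUpperTriangular) →ₗ⁅F⁆
      LieDerivation F (L.lieMatrices F hL.isUpperTriangular)
        (L.lieMatrices F hL.isUpperTriangular), ∀ g,
          hL.restrict (F := F) (σ g) = g := by
  choose A hA using fun D => hL.exists_matrix (F := F) D h2F h3F
  have hA0 : ∀ g, ∀ B ∈ L.lieMatricesZero F hL.isUpperTriangular,
      ⁅A g, B⁆ ∈ L.lieMatricesZero F hL.isUpperTriangular := fun g B hB => by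
    rw [← hA g ⟨B, hB⟩]
    exact (g ⟨B, hB⟩).2
  -- The chosen `A g` need not be linear or multiplicative in g. Only its action on M_L matters, and
  -- that is determined by its action on M_L^0, which is g.
  have key : ∀ X Y : Matrix (Fin n) (Fin n) F,
      (∀ B ∈ L.lieMatricesZero F hL.isUpperTriangular, ⁅X, B⁆ = ⁅Y, B⁆) →
      ∀ B ∈ L.matrices F, ⁅X, B⁆ = ⁅Y, B⁆ := fun X Y hXY B hB => by
    rw [← sub_eq_zero, ← sub_lie]
    refine hL.lie_eq_zero_of_forall_lieMatricesZero (fun C hC => ?_) hB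
    rw [sub_lie, hXY C hC, sub_self]
  refine ⟨{
    toFun g := hL.adDerivation (A g) fun B hB => (hA0 g B hB).1
    map_add' g g' := LieDerivation.ext fun B => Subtype.ext <| ?_
    map_smul' c g := LieDerivation.ext fun B => Subtype.ext <| ?_
    map_lie' {g g'} := LieDerivation.ext fun B => Subtype.ext <| ?_ }, fun g => ?_⟩
  · change ⁅A (g + g'), B.1⁆ = ⁅A g, B.1⁆ + ⁅A g', B.1⁆
    rw [← add_lie]
    refine key _ _ (fun C hC => ?_) B.1 B.2
    rw [add_lie, ← hA _ ⟨C, hC⟩, ← hA _ ⟨C, hC⟩, ← hA _ ⟨C, hC⟩]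
    rfl
  · change ⁅A (c • g), B.1⁆ = c • ⁅A g, B.1⁆
    rw [← smul_lie]
    refine key _ _ (fun C hC => ?_) B.1 B.2
    rw [smul_lie, ← hA _ ⟨C, hC⟩, ← hA _ ⟨C, hC⟩]
    rfl
  · rw [LieDerivation.commutator_apply]
    change ⁅A ⁅g, g'⁆, B.1⁆ = ⁅A g, ⁅A g', B.1⁆⁆ - ⁅A g', ⁅A g, B.1⁆⁆
    rw [← lie_lie]
    refine key _ _ (fun C hC => ?_) B.1 B.2
    rw [lie_lie, ← hA _ ⟨C, hC⟩, ← hA g' ⟨C, hC⟩, ← hA g ⟨C, hC⟩, ← hA, ← hA,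
      LieDerivation.commutator_apply]
    rfl
  · exact LieDerivation.ext fun B => Subtype.ext (hA g B).symm

end Ladder.IsSDUT

theorem mainTheorem7 {F : Type*} [Field F] (hF2 : ringChar F ≠ 2) (hF3 : ringChar F ≠ 3)
    {n : ℕ} (L : Ladder n) (hL : L.IsSDUT) :
    ∃ (ι : centralMaps (L.lieMatrices F hL.isUpperTriangular) →ₗ⁅F⁆
          LieDerivation F (L.lieMatrices F hL.isUpperTriangular)
            (L.lieMatrices F hL.isUpperTriangular))
      (π : LieDerivation F (L.lieMatrices F hL.isUpperTriangular)
            (L.lieMatrices F hL.isUpperTriangular) →ₗ⁅F⁆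
          LieDerivation F (L.lieMatricesZero F hL.isUpperTriangular)
            (L.lieMatricesZero F hL.isUpperTriangular)),
      -- `ι` is the inclusion
      (∀ φ A, ι φ A = φ.1 A) ∧
      -- `π` is the restriction of derivations
      (∀ f (A : L.lieMatricesZero F hL.isUpperTriangular),
        ((π f A : L.lieMatricesZero F hL.isUpperTriangular) : Matrix (Fin n) (Fin n) F) =
          (f ⟨A.1, L.lieMatricesZero_le hL.isUpperTriangular A.2⟩ :
            L.lieMatrices F hL.isUpperTriangular)) ∧
      -- the sequence is exact and splits
      LieAlgebra.IsExtension ι π ∧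
      ∃ σ : LieDerivation F (L.lieMatricesZero F hL.isUpperTriangular)
              (L.lieMatricesZero F hL.isUpperTriangular) →ₗ⁅F⁆
            LieDerivation F (L.lieMatrices F hL.isUpperTriangular)
              (L.lieMatrices F hL.isUpperTriangular),
        ∀ g, π (σ g) = g := by

  have h2F : (2 : F) ≠ 0 := Ring.two_ne_zero hF2
  have h3F : (3 : F) ≠ 0 := by
    intro h3
    rcases (Nat.dvd_prime Nat.prime_three).mp (ringChar.dvd (R := F) (by exact_mod_cast h3)) with
      h | h
    · exact CharP.ringChar_ne_one h
    · exact hF3 h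
  obtain ⟨σ, hσ⟩ := hL.exists_splitting h2F h3F
  refine ⟨hL.centralInclusion, hL.restrict, fun _ _ => rfl, fun _ _ => rfl, ⟨?_, ?_, ?_⟩, σ, hσ⟩
  · rw [LieHom.ker_eq_bot]
    intro φ ψ h
    exact Subtype.ext (LinearMap.ext fun A => LieDerivation.congr_fun h A)
  · rw [LieHom.range_eq_top]
    exact fun g => ⟨σ g, hσ g⟩
  · rw [hL.range_centralInclusion]
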